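/- Manifolds are smooth, Hausdorff, second countable, without boundary and of a fixed finite dimension. Let $G$ be a Lie group acting smoothly and transitively on a nonempty manifold $M$. For $x\in M$ let $\psi_x:G\to M$, $\psi_x(g)=g\cdot x$, and let $GM$ be the set of all $G$-equivariant maps $G\to M$, i.e. of all smooth $f:G\to M$ with $f(gh)=g\cdot f(h)$ for all $g,h\in G$; every such $f$ equals $\psi_x$ for exactly one $x\in M$. The induced action of $G$ on $GM$ is $g\cdot\psi_x=\psi_{g\cdot x}$. Then: 1. There is exactly one manifold topology and smooth structure (maximal smooth atlas) on the set $GM$ for which the induced action $G\times GM\to GM$ is smooth. 2. A manifold topology and smooth structure on $GM$ is the one in 1 if and only if $\psi:M\to GM$, $x\mapsto\psi_x$, is a diffeomorphism. In particular, $GM\cong M$. 3. Let $x\in M$ be arbitrary and let $H=\{g\in G: g\cdot x=x\}$ be its isotropy group. There is exactly one smooth manifold structure on the left coset space $G/H$ with the quotient topology for which the projection $G\to G/H$ is a smooth submersion. With it, $G/H\to M$, $gH\mapsto g\cdot x$, is a diffeomorphism, and a manifold topology and smooth structure on $GM$ is the one in 1 if and only if $G/H\to GM$, $gH\mapsto g\cdot\psi_x=\psi_{g\cdot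 x}$, is a diffeomorphism. In particular, $GM\cong M\cong G/H$. 4. In particular, for the action of $G$ on itself by left translations, there is exactly one manifold topology and smooth structure on $GG$ for which the induced action is smooth, and a manifold topology and smooth structure on $GG$ is this one if and only if $g\mapsto\psi_g$ (where $\psi_g(h)=hg$) is a diffeomorphism $G\to GG$. In particular, $GG\cong G$. -/

import Mathlib

open scoped Manifold ContDiff

/-- A manifold topology together with a smooth structure on a set `X`: a Hausdorff and second
countable topology and a *maximal* smooth atlas of charts with values in `ℝ ^ dim`. Since the atlas
is maximal, two such structures are equal as soon as they have the same dimension, the same open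
sets and the same smooth charts. -/
structure SmoothStructure (X : Type*) where
  dim : ℕ
  [topology : TopologicalSpace X]
  t2Space : T2Space X
  secondCountable : SecondCountableTopology X
  charts : Set (OpenPartialHomeomorph X (EuclideanSpace ℝ (Fin dim)))
  exists_chart : ∀ x, ∃ e ∈ charts, x ∈ e.source
  compatible : ∀ e ∈ charts, ∀ e' ∈ charts, e.symm.trans e' ∈ contDiffGroupoid ∞ (𝓡 dim)
  maximal : ∀ e : OpenPartialHomeomorph X (EuclideanSpace ℝ (Fin dim)),
    (∀ e' ∈ charts, e.symm.trans e' ∈ contDiffGroupoid ∞ (𝓡 dim) ∧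
      e'.symm.trans e ∈ contDiffGroupoid ∞ (𝓡 dim)) → e ∈ charts

namespace SmoothStructure

/-- The set `X` regarded as a smooth manifold by means of the structure `S`. -/
def Space {X : Type*} (_S : SmoothStructure X) : Type _ := X

/-- The identity map from the set `X` to the manifold `(X, S)`. -/
def toSpace {X : Type*} (S : SmoothStructure X) : X ≃ S.Space := Equiv.refl X

instance {X : Type*} (S : SmoothStructure X) : TopologicalSpace S.Space := S.topology

instance {X : Type*} (S : SmoothStructure X) : T2Space S.Space := S.t2Space

instance {X : Type*} (S : SmoothStructure X) : SecondCountableTopology S.Space :=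
  S.secondCountable

noncomputable instance {X : Type*} (S : SmoothStructure X) :
    ChartedSpace (EuclideanSpace ℝ (Fin S.dim)) S.Space where
  atlas := S.charts
  chartAt x := Classical.choose (S.exists_chart x)
  mem_chart_source x := (Classical.choose_spec (S.exists_chart x)).2
  chart_mem_atlas x := (Classical.choose_spec (S.exists_chart x)).1

instance {X : Type*} (S : SmoothStructure X) : IsManifold (𝓡 S.dim) ∞ S.Space where
  compatible := fun {e e'} he he' => S.compatible e he e' he'

/-- An action of `G` on the set `X` is an action on the manifold `(X, S)`. -/
instance {G X : Type*} [Monoid G] [MulAction G X] (S : SmoothStructure X) :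
    MulAction G S.Space := inferInstanceAs (MulAction G X)

theorem smul_toSpace {G X : Type*} [Monoid G] [MulAction G X] (S : SmoothStructure X)
    (g : G) (x : X) : g • S.toSpace x = S.toSpace (g • x) := rfl

/-- `Q` is the quotient manifold structure on the left coset space `G ⧸ H`: its topology is the
quotient topology and the projection `G → G ⧸ H` is a smooth submersion. -/
structure IsQuotientStructure (r : ℕ) {G : Type*} [Group G] [TopologicalSpace G]
    [ChartedSpace (EuclideanSpace ℝ (Fin r)) G] {H : Subgroup G}
    (Q : SmoothStructure (G ⧸ H)) : Prop where
  topology_eq : Q.topology = TopologicalSpace.coinduced (fun g : G => (g : G ⧸ H)) inferInstance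
  contMDiff_mk : ContMDiff (𝓡 r) (𝓡 Q.dim) ∞ (fun g : G => Q.toSpace (g : G ⧸ H))
  surjective_mfderiv : ∀ g : G, Function.Surjective
    (mfderiv (𝓡 r) (𝓡 Q.dim) (fun g : G => Q.toSpace (g : G ⧸ H)) g)

end SmoothStructure

/-- The set `GM` of all `G`-equivariant maps from `G` (with the action by left translations) to the
`G`-manifold `M`: the smooth maps `f : G → M` with `f (g * h) = g • f h`. Here `r` and `m` are the
dimensions of `G` and `M`. -/
structure EquivariantMap (r m : ℕ) (G M : Type*) [Group G] [TopologicalSpace G]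
    [ChartedSpace (EuclideanSpace ℝ (Fin r)) G] [TopologicalSpace M]
    [ChartedSpace (EuclideanSpace ℝ (Fin m)) M] [MulAction G M] extends G →[G] M where
  contMDiff_toFun : ContMDiff (𝓡 r) (𝓡 m) ∞ toFun

namespace EquivariantMap

variable {r m : ℕ} {G M : Type*} [Group G] [TopologicalSpace G]
  [ChartedSpace (EuclideanSpace ℝ (Fin r)) G] [TopologicalSpace M]
  [ChartedSpace (EuclideanSpace ℝ (Fin m)) M] [MulAction G M]

theorem ext_one {f f' : EquivariantMap r m G M} (h : f.toFun 1 = f'.toFun 1) : f = f' := by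
  obtain ⟨⟨f, hf⟩, hs⟩ := f
  obtain ⟨⟨f', hf'⟩, hs'⟩ := f'
  have : f = f' := by
    funext g
    have h1 := hf g 1
    have h2 := hf' g 1
    simp only [smul_eq_mul, mul_one, id_eq] at h1 h2
    rw [h1, h2]
    exact congrArg (g • ·) h
  subst this
  rfl

variable [ContMDiffSMul (𝓡 r) (𝓡 m) ∞ G M]

variable (r m G) in
/-- The map `ψ_x : G → M`, `g ↦ g • x`, as an element of `GM`. -/
def psi (x : M) : EquivariantMap r m G M where
  toFun g := g • x
  map_smul' g h := mul_smul g h x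
  contMDiff_toFun := (contMDiff_smul (I := 𝓡 r) (I' := 𝓡 m) (n := ∞) (G := G) (M := M)).comp
    (contMDiff_id.prodMk contMDiff_const)

theorem psi_apply (x : M) (g : G) : (psi r m G x).toFun g = g • x := rfl

/-- Every equivariant map `f` is `ψ_x` for exactly one point, namely `x = f 1`. -/
theorem psi_apply_one (f : EquivariantMap r m G M) : psi r m G (f.toFun 1) = f :=
  ext_one (one_smul G _)

/-- The induced action of `G` on `GM`: `g • ψ_x = ψ_{g • x}`, see `smul_psi`. -/
instance : MulAction G (EquivariantMap r m G M) where
  smul g f := psi r m G (g • f.toFun 1)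
  one_smul f := ext_one (by
    change (1 : G) • (1 : G) • f.toFun 1 = f.toFun 1
    simp only [one_smul])
  mul_smul g h f := ext_one (by
    change (1 : G) • (g * h) • f.toFun 1 = (1 : G) • g • (1 : G) • h • f.toFun 1
    simp only [one_smul, mul_smul])

theorem smul_psi (g : G) (x : M) : g • psi r m G x = psi r m G (g • x) := by
  change psi r m G (g • (1 : G) • x) = _
  rw [one_smul]

end EquivariantMap

/-! Everything rests on one regularity fact, `contMDiff_of_map_smul`: an equivariant map `F` out of
a transitive smooth `G`-manifold is automatically smooth. Indeed `F` composed with the orbit map of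
`x` is the orbit map of `F x`, which is smooth, and smoothness descends along submersions because
they have local sections. Applied to an equivariant bijection and to its inverse, this shows that a
structure makes the action smooth exactly when the bijection is a diffeomorphism. Existence then
follows by transport from `M`, and uniqueness because the identity between two such structures is a
diffeomorphism.

What remains is that orbit maps are submersions (`surjective_mfderiv_smul_const`). Their rank is
constant by equivariance, and they are open by a Baire category argument. A map of locally maximal
rank factors locally through the projection of its values to the range of its derivative, so if that
range were proper the map could not be open.

For `G ⧸ H`, the projection and the orbit map are surjective submersions with the same fibres, so
smoothness descends along either. -/

open Filter Topology

/-! ### Calculus in vector spaces: bounded rank, open maps, local sections -/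

/-- If the rank of `fderiv ℝ f` near `x` is at most the dimension of `W` and `π ∘ f` is a submersion
to `W` at `x`, then `f` factors through `π ∘ f` near `x`. -/
theorem ContDiffAt.exists_nhds_forall_eq_of_comp_eq {E F W : Type*}
    [NormedAddCommGroup E] [NormedSpace ℝ E] [FiniteDimensional ℝ E]
    [NormedAddCommGroup F] [NormedSpace ℝ F]
    [NormedAddCommGroup W] [NormedSpace ℝ W] [FiniteDimensional ℝ W]
    {f : E → F} {x : E} (hf : ContDiffAt ℝ 1 f x) (π : F →L[ℝ] W)
    (hπ : Function.Surjective (π ∘L fderiv ℝ f x))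
    (hrank : ∀ᶠ y in 𝓝 x,
      Module.finrank ℝ (LinearMap.range (fderiv ℝ f y).toLinearMap) ≤ Module.finrank ℝ W) :
    ∃ U ∈ 𝓝 x, ∀ y ∈ U, ∀ z ∈ U, π (f y) = π (f z) → f y = f z := by
  have hfx : HasFDerivAt f (fderiv ℝ f x) x := (hf.differentiableAt one_ne_zero).hasFDerivAt
  set g' := π ∘L fderiv ℝ f x with hg'
  obtain ⟨P, hP⟩ := Submodule.ClosedComplemented.of_finiteDimensional (𝕜 := ℝ)
    (LinearMap.ker g'.toLinearMap)
  have hPs : P.range = ⊤ := LinearMap.range_eq_top.2 fun k => ⟨k, hP k⟩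
  let A : E ≃L[ℝ] W × LinearMap.ker g'.toLinearMap :=
    g'.equivProdOfSurjectiveOfIsCompl P (LinearMap.range_eq_top.2 hπ) hPs
      (LinearMap.isCompl_of_proj hP)
  -- By the inverse function theorem `Φ` is a local chart at `x`, and in it `π ∘ f` becomes the
  -- first projection.
  let Φ : E → W × LinearMap.ker g'.toLinearMap := fun y => (π (f y), P y)
  have hΦ : ContDiffAt ℝ 1 Φ x := (π.contDiff.contDiffAt.comp x hf).prodMk P.contDiff.contDiffAt
  have hΦ' : HasFDerivAt Φ (A : E →L[ℝ] W × LinearMap.ker g'.toLinearMap) x :=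
    (π.hasFDerivAt.comp x hfx).prodMk P.hasFDerivAt
  let e := hΦ.toOpenPartialHomeomorph Φ hΦ' one_ne_zero
  have hxe : x ∈ e.source := hΦ.mem_toOpenPartialHomeomorph_source hΦ' one_ne_zero
  have hex : e.symm (Φ x) = x := e.left_inv hxe
  have htar : Φ x ∈ e.target := e.map_source hxe
  have hsymm : ContDiffAt ℝ 1 e.symm (Φ x) := by
    refine e.contDiffAt_symm htar (f₀' := A) ?_ ?_
    · rw [hex]; exact hΦ'
    · rw [hex]; exact hΦ
  have htend : Tendsto e.symm (𝓝 (Φ x)) (𝓝 x) := by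
    have := hsymm.continuousAt.tendsto
    rwa [hex] at this
  have hgood : ∀ᶠ q in 𝓝 (Φ x), q ∈ e.target ∧ DifferentiableAt ℝ e.symm q ∧
      DifferentiableAt ℝ f (e.symm q) ∧
      Module.finrank ℝ (LinearMap.range (fderiv ℝ f (e.symm q)).toLinearMap) ≤
        Module.finrank ℝ W := by
    filter_upwards [e.open_target.mem_nhds htar, hsymm.eventually (by simp),
      htend.eventually (hf.eventually (by simp)), htend.eventually hrank] with q h1 h2 h3 h4
    exact ⟨h1, h2.differentiableAt one_ne_zero, h3.differentiableAt one_ne_zero, h4⟩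
  obtain ⟨ε, hε, hball⟩ := Metric.eventually_nhds_iff_ball.1 hgood
  -- `π` maps the range of the derivative of `f` onto `W`; by the rank bound it is injective there.
  -- It kills the image of `(0, κ)`, so that image is zero.
  have hkey : ∀ q ∈ Metric.ball (Φ x) ε, ∀ κ, fderiv ℝ (f ∘ e.symm) q (0, κ) = 0 := by
    intro q hq κ
    obtain ⟨h1, h2, h3, h4⟩ := hball q hq
    have hD : HasFDerivAt (f ∘ e.symm) (fderiv ℝ f (e.symm q) ∘L fderiv ℝ e.symm q) q :=
      h3.hasFDerivAt.comp q h2.hasFDerivAt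
    have hfst : π ∘L (fderiv ℝ f (e.symm q) ∘L fderiv ℝ e.symm q) =
        ContinuousLinearMap.fst ℝ W (LinearMap.ker g'.toLinearMap) := by
      refine (π.hasFDerivAt.comp q hD).unique (hasFDerivAt_fst.congr_of_eventuallyEq ?_)
      filter_upwards [e.open_target.mem_nhds h1] with p hp
      exact congrArg Prod.fst (e.right_inv hp)
    have hinj : Function.Injective
        (π.toLinearMap.domRestrict (LinearMap.range (fderiv ℝ f (e.symm q)).toLinearMap)) := by
      have hsurj : Function.Surjective
          (π.toLinearMap.domRestrict (LinearMap.range (fderiv ℝ f (e.symm q)).toLinearMap)) := by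
        intro w
        exact ⟨⟨_, ⟨fderiv ℝ e.symm q (w, 0), rfl⟩⟩, DFunLike.congr_fun hfst (w, 0)⟩
      refine (LinearMap.injective_iff_surjective_of_finrank_eq_finrank ?_).2 hsurj
      exact h4.antisymm (LinearMap.finrank_le_finrank_of_surjective hsurj)
    rw [hD.fderiv]
    have := @hinj ⟨_, ⟨fderiv ℝ e.symm q (0, κ), rfl⟩⟩ 0 (by
      rw [map_zero]; exact DFunLike.congr_fun hfst (0, κ))
    exact congrArg Subtype.val this
  refine ⟨e.source ∩ e ⁻¹' Metric.ball (Φ x) ε,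
    inter_mem (e.open_source.mem_nhds hxe)
      ((e.continuousAt hxe).preimage_mem_nhds (Metric.ball_mem_nhds _ hε)), ?_⟩
  rintro y ⟨hy, hyb⟩ z ⟨hz, hzb⟩ hyz
  have hy' : f y = (f ∘ e.symm) (Φ y) := congrArg f (e.left_inv hy).symm
  have hz' : f z = (f ∘ e.symm) (Φ z) := congrArg f (e.left_inv hz).symm
  rw [hy', hz']
  -- When `π (f y) = π (f z)`, the segment from `Φ y` to `Φ z` stays in the ball and points in a
  -- kernel direction, along which `f ∘ e.symm` is constant.
  have hseg : ∀ t ∈ Set.Icc (0 : ℝ) 1, AffineMap.lineMap (Φ y) (Φ z) t ∈ Metric.ball (Φ x) ε :=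
    fun t ht => (convex_ball (Φ x) ε).lineMap_mem hyb hzb ht
  have hdir : Φ z - Φ y = (0, P z - P y) := by simp [Φ, hyz]
  have hder : ∀ t ∈ Set.Icc (0 : ℝ) 1,
      HasDerivAt (fun t : ℝ => (f ∘ e.symm) (AffineMap.lineMap (Φ y) (Φ z) t)) 0 t := by
    intro t ht
    obtain ⟨h1, h2, h3, h4⟩ := hball _ (hseg t ht)
    have := (h3.comp _ h2).hasFDerivAt.comp_hasDerivAt t
      (AffineMap.hasDerivAt_lineMap (a := Φ y) (b := Φ z) (x := t))
    rwa [hdir, hkey _ (hseg t ht)] at this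
  have := constant_of_has_deriv_right_zero
    (fun t ht => (hder t ht).continuousAt.continuousWithinAt)
    (fun t ht => (hder t ⟨ht.1, ht.2.le⟩).hasDerivWithinAt) 1 ⟨zero_le_one, le_rfl⟩
  simpa using this.symm

/-- A map which is open at `x` and whose derivative has locally maximal rank at `x` is a submersion
at `x`. -/
theorem ContDiffAt.surjective_fderiv_of_nhds_le_map {E F : Type*}
    [NormedAddCommGroup E] [NormedSpace ℝ E] [FiniteDimensional ℝ E]
    [NormedAddCommGroup F] [NormedSpace ℝ F]
    {f : E → F} {x : E} (hf : ContDiffAt ℝ 1 f x)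
    (hrank : ∀ᶠ y in 𝓝 x, Module.finrank ℝ (LinearMap.range (fderiv ℝ f y).toLinearMap) ≤
      Module.finrank ℝ (LinearMap.range (fderiv ℝ f x).toLinearMap))
    (hopen : 𝓝 (f x) ≤ map f (𝓝 x)) : Function.Surjective (fderiv ℝ f x) := by
  obtain ⟨π, hπ⟩ := Submodule.ClosedComplemented.of_finiteDimensional (𝕜 := ℝ)
    (LinearMap.range (fderiv ℝ f x).toLinearMap)
  obtain ⟨U, hU, hinj⟩ := hf.exists_nhds_forall_eq_of_comp_eq π (by
    rintro ⟨_, ⟨v, rfl⟩⟩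
    exact ⟨v, hπ ⟨_, ⟨v, rfl⟩⟩⟩) hrank
  intro v
  -- Moving from `f x` along `v - π v` does not change `π`. Openness puts such a point with `t ≠ 0`
  -- in `f '' U`, and injectivity of `π` on `f '' U` makes it equal to `f x`, so `v = π v`.
  have hline : Tendsto (fun t : ℝ => f x + t • (v - π v)) (𝓝[≠] 0) (𝓝 (f x)) := by
    have : Continuous fun t : ℝ => f x + t • (v - (π v : F)) := by fun_prop
    have h0 := this.tendsto 0
    simp only [zero_smul, add_zero] at h0
    exact h0.mono_left nhdsWithin_le_nhds
  obtain ⟨t, ⟨y, hy, hyt⟩, ht⟩ :=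
    ((hline.eventually (hopen (image_mem_map hU))).and self_mem_nhdsWithin).exists
  have hyx : f y = f x := by
    refine hinj y hy x (mem_of_mem_nhds hU) ?_
    rw [hyt, map_add, map_smul, map_sub, hπ, sub_self, smul_zero, add_zero]
  have hv : v = π v := by
    rw [hyx] at hyt
    exact sub_eq_zero.1 ((smul_eq_zero.1 (add_eq_left.1 hyt.symm)).resolve_left ht)
  obtain ⟨w, hw⟩ := (π v).2
  exact ⟨w, hw.trans hv.symm⟩

/-- A map with surjective derivative has a local section. -/
theorem ContDiffAt.exists_section_of_surjective_fderiv {E F : Type*}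
    [NormedAddCommGroup E] [NormedSpace ℝ E]
    [NormedAddCommGroup F] [NormedSpace ℝ F] [FiniteDimensional ℝ F]
    {n : ℕ∞ω} {f : E → F} {x : E} (hf : ContDiffAt ℝ n f x) (hn : n ≠ 0)
    (hs : Function.Surjective (fderiv ℝ f x)) :
    ∃ s : F → E, ContDiffAt ℝ n s (f x) ∧ s (f x) = x ∧ ∀ᶠ y in 𝓝 (f x), f (s y) = y := by
  have : CompleteSpace F := FiniteDimensional.complete ℝ F
  obtain ⟨R, hR⟩ := (fderiv ℝ f x).exists_rightInverse_of_surjective (LinearMap.range_eq_top.2 hs)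
  -- On this affine slice `f ∘ a` has derivative the identity, so it can be inverted locally.
  let a : F → E := fun y => x + R (y - f x)
  have ha : ContDiff ℝ n a := by fun_prop
  have hax : a (f x) = x := by simp [a]
  have ha' : HasFDerivAt a R (f x) :=
    (R.hasFDerivAt.comp (f x) ((hasFDerivAt_id (f x)).sub_const (f x))).const_add x
  have hfa : ContDiffAt ℝ n (f ∘ a) (f x) := by
    refine ContDiffAt.comp _ ?_ ha.contDiffAt
    rwa [hax]
  have hfa' : HasFDerivAt (f ∘ a) (ContinuousLinearEquiv.refl ℝ F : F →L[ℝ] F) (f x) := by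
    have h1 : HasFDerivAt f (fderiv ℝ f x) (a (f x)) := by
      rw [hax]; exact (hf.differentiableAt hn).hasFDerivAt
    have := h1.comp (f x) ha'
    rw [hR] at this
    exact this
  have hfix : (f ∘ a) (f x) = f x := congrArg f hax
  have hsec : ∀ᶠ y in 𝓝 ((f ∘ a) (f x)), (f ∘ a) (hfa.localInverse hfa' hn y) = y :=
    (hfa.hasStrictFDerivAt' hfa' hn).eventually_right_inverse
  have hval := hfa.localInverse_apply_image hfa' hn
  have hsm := hfa.to_localInverse hfa' hn
  rw [hfix] at hsec hval hsm
  refine ⟨a ∘ hfa.localInverse hfa' hn, ha.contDiffAt.comp _ hsm, ?_, hsec⟩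
  simp only [Function.comp, hval, hax]

/-! ### Submersions of manifolds -/

section Submersion

variable {E : Type*} [NormedAddCommGroup E] [NormedSpace ℝ E] {H : Type*} [TopologicalSpace H]
  {I : ModelWithCorners ℝ E H} [I.Boundaryless]
  {M : Type*} [TopologicalSpace M] [ChartedSpace H M]
  {E' : Type*} [NormedAddCommGroup E'] [NormedSpace ℝ E'] {H' : Type*} [TopologicalSpace H']
  {J : ModelWithCorners ℝ E' H'} [J.Boundaryless]
  {N : Type*} [TopologicalSpace N] [ChartedSpace H' N]
  {E'' : Type*} [NormedAddCommGroup E''] [NormedSpace ℝ E''] {H'' : Type*} [TopologicalSpace H'']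
  {K : ModelWithCorners ℝ E'' H''} {P : Type*} [TopologicalSpace P] [ChartedSpace H'' P]
  {n : ℕ∞ω} {f : M → N} {x : M}

omit [J.Boundaryless] in
theorem ContMDiffAt.contDiffAt_writtenInExtChartAt (hf : ContMDiffAt I J n f x) :
    ContDiffAt ℝ n (writtenInExtChartAt I J x f) (extChartAt I x x) := by
  have := (contMDiffAt_iff.1 hf).2
  rwa [I.range_eq_univ, contDiffWithinAt_univ] at this

omit [J.Boundaryless] in
theorem ContMDiffAt.mfderiv_eq_fderiv_writtenInExtChartAt (hf : ContMDiffAt I J n f x)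
    (hn : n ≠ 0) :
    mfderiv I J f x = fderiv ℝ (writtenInExtChartAt I J x f) (extChartAt I x x) := by
  refine (hf.mdifferentiableAt hn).mfderiv.trans ?_
  rw [I.range_eq_univ, fderivWithin_univ]

theorem contMDiffAt_extChartAt_symm_self (x : M) :
    ContMDiffAt 𝓘(ℝ, E) I n (extChartAt I x).symm (extChartAt I x x) := by
  have := contMDiffWithinAt_extChartAt_symm_range_self (I := I) (n := n) x
  rwa [I.range_eq_univ, contMDiffWithinAt_univ] at this

omit [J.Boundaryless] in
/-- A submersion has local sections. -/
theorem ContMDiffAt.exists_section_of_surjective_mfderiv [FiniteDimensional ℝ E']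
    (hf : ContMDiffAt I J n f x) (hn : n ≠ 0) (hs : Function.Surjective (mfderiv I J f x)) :
    ∃ s : N → M, ContMDiffAt J I n s (f x) ∧ s (f x) = x ∧ ∀ᶠ y in 𝓝 (f x), f (s y) = y := by
  rw [hf.mfderiv_eq_fderiv_writtenInExtChartAt hn] at hs
  obtain ⟨σ, hσ, hσx, hσs⟩ :=
    hf.contDiffAt_writtenInExtChartAt.exists_section_of_surjective_fderiv hn hs
  have hFx : writtenInExtChartAt I J x f (extChartAt I x x) = extChartAt J (f x) (f x) := by
    simp [writtenInExtChartAt]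
  rw [hFx] at hσ hσx hσs
  have h1 : ContMDiffAt J I n ((extChartAt I x).symm ∘ σ ∘ extChartAt J (f x)) (f x) := by
    refine ContMDiffAt.comp (I' := 𝓘(ℝ, E)) (f x) ?_
      (ContMDiffAt.comp (I' := 𝓘(ℝ, E')) (f x) hσ.contMDiffAt contMDiffAt_extChartAt)
    simp only [Function.comp, hσx]
    exact contMDiffAt_extChartAt_symm_self x
  have hval : ((extChartAt I x).symm ∘ σ ∘ extChartAt J (f x)) (f x) = x := by
    simp only [Function.comp, hσx, extChartAt_to_inv]
  refine ⟨_, h1, hval, ?_⟩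
  have hcont : ContinuousAt (f ∘ (extChartAt I x).symm ∘ σ ∘ extChartAt J (f x)) (f x) := by
    refine ContinuousAt.comp ?_ h1.continuousAt
    rw [hval]
    exact hf.continuousAt
  -- The section identity is known only in coordinates; cancelling the chart requires `f (s y)` to
  -- remain in its source.
  have hsrc : ∀ᶠ y in 𝓝 (f x),
      (f ∘ (extChartAt I x).symm ∘ σ ∘ extChartAt J (f x)) y ∈ (extChartAt J (f x)).source := by
    refine hcont.eventually ?_
    rw [Function.comp, hval]
    exact extChartAt_source_mem_nhds (f x)
  filter_upwards [hsrc, extChartAt_source_mem_nhds (I := J) (f x),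
    (continuousAt_extChartAt (I := J) (f x)).eventually hσs] with y h2 h3 h4
  exact (extChartAt J (f x)).injOn h2 h3 h4

omit [J.Boundaryless] in
/-- A map is smooth at `f x` if its composition with the submersion `f` is smooth at `x`. -/
theorem ContMDiffAt.of_comp_submersion [FiniteDimensional ℝ E']
    (hf : ContMDiffAt I J n f x) (hn : n ≠ 0) (hs : Function.Surjective (mfderiv I J f x))
    {g : N → P} (hg : ContMDiffAt I K n (g ∘ f) x) : ContMDiffAt J K n g (f x) := by
  obtain ⟨s, hsm, hsx, hsec⟩ := hf.exists_section_of_surjective_mfderiv hn hs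
  have : ContMDiffAt J K n ((g ∘ f) ∘ s) (f x) := by
    refine ContMDiffAt.comp (f x) ?_ hsm
    rwa [hsx]
  refine this.congr_of_eventuallyEq ?_
  filter_upwards [hsec] with y hy
  simp only [Function.comp, hy]

omit [J.Boundaryless] in
theorem ContMDiff.of_comp_submersion [FiniteDimensional ℝ E']
    (hf : ContMDiff I J n f) (hn : n ≠ 0) (hsurj : Function.Surjective f)
    (hs : ∀ x, Function.Surjective (mfderiv I J f x))
    {g : N → P} (hg : ContMDiff I K n (g ∘ f)) : ContMDiff J K n g := by
  intro y
  obtain ⟨x, rfl⟩ := hsurj y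
  exact (hf x).of_comp_submersion hn (hs x) (hg x)

/-- A map which is open at `x` and whose rank is locally maximal at `x` is a submersion at `x`. -/
theorem ContMDiff.surjective_mfderiv_of_nhds_le_map [FiniteDimensional ℝ E]
    [IsManifold I n M] [IsManifold J n N]
    (hf : ContMDiff I J n f) (hn : 1 ≤ n)
    (hrank : ∀ y, Module.finrank ℝ (LinearMap.range (mfderiv I J f y).toLinearMap) ≤
      Module.finrank ℝ (LinearMap.range (mfderiv I J f x).toLinearMap))
    (hopen : 𝓝 (f x) ≤ map f (𝓝 x)) : Function.Surjective (mfderiv I J f x) := by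
  have hn0 : n ≠ 0 := (zero_lt_one.trans_le hn).ne'
  rw [(hf x).mfderiv_eq_fderiv_writtenInExtChartAt hn0]
  refine (((hf x).contDiffAt_writtenInExtChartAt).of_le hn).surjective_fderiv_of_nhds_le_map ?_ ?_
  · have hsrc : ∀ᶠ p in 𝓝 (extChartAt I x x),
        f ((extChartAt I x).symm p) ∈ (chartAt H' (f x)).source := by
      refine (((hf x).continuousAt.comp_of_eq
        (continuousAt_extChartAt_symm (I := I) x) (extChartAt_to_inv x))).eventually ?_
      rw [Function.comp, extChartAt_to_inv]
      exact (chartAt H' (f x)).open_source.mem_nhds (mem_chart_source H' (f x))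
    filter_upwards [hsrc, extChartAt_target_mem_nhds (I := I) x] with p hp hpt
    rw [← (hf x).mfderiv_eq_fderiv_writtenInExtChartAt hn0]
    refine le_trans ?_ (hrank ((extChartAt I x).symm p))
    -- The charts stay centred at `x` and `f x` while `p` varies, so the coordinate derivative is
    -- that of `f` composed with chart derivatives, which cannot raise the rank.
    have h1 : MDifferentiableAt 𝓘(ℝ, E) I (extChartAt I x).symm p :=
      ((contMDiffOn_extChartAt_symm (n := n) x).contMDiffAt
        ((isOpen_extChartAt_target x).mem_nhds hpt)).mdifferentiableAt hn0
    have h2 : MDifferentiableAt I J f ((extChartAt I x).symm p) := (hf _).mdifferentiableAt hn0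
    have h3 : MDifferentiableAt J 𝓘(ℝ, E') (extChartAt J (f x)) (f ((extChartAt I x).symm p)) :=
      (contMDiffAt_extChartAt' (n := n) hp).mdifferentiableAt hn0
    have h4 := ((h3.hasMFDerivAt.comp _ h2.hasMFDerivAt).comp p h1.hasMFDerivAt).mfderiv
    rw [mfderiv_eq_fderiv] at h4
    change Module.finrank ℝ (LinearMap.range
      (fderiv ℝ ((extChartAt J (f x) ∘ f) ∘ (extChartAt I x).symm) p).toLinearMap) ≤ _
    rw [h4]
    change Module.finrank ℝ (LinearMap.range
      (((mfderiv J 𝓘(ℝ, E') (extChartAt J (f x)) (f ((extChartAt I x).symm p))).toLinearMap ∘ₗ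
      (mfderiv I J f ((extChartAt I x).symm p)).toLinearMap) ∘ₗ
      (mfderiv 𝓘(ℝ, E) I (extChartAt I x).symm p).toLinearMap)) ≤ _
    have : FiniteDimensional ℝ (TangentSpace I ((extChartAt I x).symm p)) :=
      inferInstanceAs (FiniteDimensional ℝ E)
    refine (Submodule.finrank_mono (LinearMap.range_comp_le_range _ _)).trans ?_
    rw [LinearMap.range_comp]
    exact Submodule.finrank_map_le _ _
  · have hφ : map (extChartAt I x).symm (𝓝 (extChartAt I x x)) = 𝓝 x := by
      have := map_extChartAt_symm_nhdsWithin_range (I := I) x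
      rwa [I.range_eq_univ, nhdsWithin_univ] at this
    have hχ : map (extChartAt J (f x)) (𝓝 (f x)) = 𝓝 (extChartAt J (f x) (f x)) := by
      have := map_extChartAt_nhds (I := J) (f x)
      rwa [J.range_eq_univ, nhdsWithin_univ] at this
    have hFx : writtenInExtChartAt I J x f (extChartAt I x x) = extChartAt J (f x) (f x) := by
      simp [writtenInExtChartAt]
    rw [hFx, writtenInExtChartAt, ← map_map, ← map_map, hφ, ← hχ]
    exact map_mono hopen

end Submersion

/-! ### Orbit maps and equivariant maps -/

section TransitiveAction

variable {E : Type*} [NormedAddCommGroup E] [NormedSpace ℝ E]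
  {H : Type*} [TopologicalSpace H] (I : ModelWithCorners ℝ E H)
  {G : Type*} [Group G] [TopologicalSpace G] [ChartedSpace H G]
  {E' : Type*} [NormedAddCommGroup E'] [NormedSpace ℝ E']
  {H' : Type*} [TopologicalSpace H'] (J : ModelWithCorners ℝ E' H')
  {M : Type*} [TopologicalSpace M] [ChartedSpace H' M] [MulAction G M] (n : ℕ∞ω)

theorem contMDiff_smul_const [ContMDiffSMul I J n G M] (x : M) :
    ContMDiff I J n (fun g : G => g • x) :=
  (contMDiff_smul (I := I) (I' := J) (n := n) (G := G) (M := M)).comp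
    (contMDiff_id.prodMk contMDiff_const)

theorem contMDiff_const_smul_of_contMDiffSMul [ContMDiffSMul I J n G M] (g : G) :
    ContMDiff J J n (fun x : M => g • x) :=
  (contMDiff_smul (I := I) (I' := J) (n := n) (G := G) (M := M)).comp
    (contMDiff_const.prodMk contMDiff_id)

variable {n}

/-- The orbit maps of a smooth action have constant rank. -/
theorem finrank_range_mfderiv_smul_const_le [FiniteDimensional ℝ E] [LieGroup I n G]
    [ContMDiffSMul I J n G M] (hn : n ≠ 0) (x : M) (g h : G) :
    Module.finrank ℝ (LinearMap.range (mfderiv I J (fun g : G => g • x) h).toLinearMap) ≤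
      Module.finrank ℝ (LinearMap.range (mfderiv I J (fun g : G => g • x) g).toLinearMap) := by
  -- The inner left translation carries `h` to `g`, so the chain rule bounds the rank at `h` by the
  -- rank at `g`.
  have hcomp : (fun k : G => k • x) =
      ((fun y : M => (h * g⁻¹) • y) ∘ fun k : G => k • x) ∘ fun k : G => (g * h⁻¹) * k := by
    funext k
    simp [smul_smul, mul_assoc]
  have h1 : MDifferentiableAt I I (fun k : G => (g * h⁻¹) * k) h :=
    (contMDiff_mul_left (n := n) (I := I)).mdifferentiableAt hn
  have hgh : (g * h⁻¹) * h = g := by simp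
  have h2 : MDifferentiableAt I J (fun k : G => k • x) ((g * h⁻¹) * h) :=
    (contMDiff_smul_const I J n x).mdifferentiableAt hn
  have h3 : MDifferentiableAt J J (fun y : M => (h * g⁻¹) • y) (((g * h⁻¹) * h) • x) :=
    (contMDiff_const_smul_of_contMDiffSMul I J n (h * g⁻¹)).mdifferentiableAt hn
  have h4 := ((h3.hasMFDerivAt.comp ((g * h⁻¹) * h) h2.hasMFDerivAt).comp h h1.hasMFDerivAt).mfderiv
  rw [← hcomp] at h4
  have hle : Module.finrank ℝ (LinearMap.range (mfderiv I J (fun g : G => g • x) h).toLinearMap) ≤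
      Module.finrank ℝ (LinearMap.range
        (mfderiv I J (fun g : G => g • x) ((g * h⁻¹) * h)).toLinearMap) := by
    rw [h4]
    change Module.finrank ℝ (LinearMap.range
      (((mfderiv J J (fun y : M => (h * g⁻¹) • y) (((g * h⁻¹) * h) • x)).toLinearMap ∘ₗ
      (mfderiv I J (fun g : G => g • x) ((g * h⁻¹) * h)).toLinearMap) ∘ₗ
      (mfderiv I I (fun k : G => (g * h⁻¹) * k) h).toLinearMap)) ≤ _
    have : FiniteDimensional ℝ (TangentSpace I ((g * h⁻¹) * h)) :=
      inferInstanceAs (FiniteDimensional ℝ E)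
    refine (Submodule.finrank_mono (LinearMap.range_comp_le_range _ _)).trans ?_
    rw [LinearMap.range_comp]
    exact Submodule.finrank_map_le _ _
  rwa [hgh] at hle

variable [FiniteDimensional ℝ E] [I.Boundaryless] [SecondCountableTopology G] [LieGroup I n G]
  [FiniteDimensional ℝ E'] [J.Boundaryless] [T2Space M] [IsManifold J n M]
  [ContMDiffSMul I J n G M] [MulAction.IsPretransitive G M]

/-- The orbit maps of a transitive smooth action are submersions. -/
theorem surjective_mfderiv_smul_const (hn : 1 ≤ n) (x : M) (g : G) :
    Function.Surjective (mfderiv I J (fun g : G => g • x) g) := by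
  -- Openness of the orbit map is a Baire argument: `G` is σ-compact, being locally compact and
  -- second countable, and `M` is Baire, being locally compact and Hausdorff.
  have : IsTopologicalGroup G := topologicalGroup_of_lieGroup I n
  have : ContinuousSMul G M := ContMDiffSMul.continuousSMul (I := I) (I' := J) n
  have : LocallyCompactSpace G := Manifold.locallyCompact_of_finiteDimensional I
  have : LocallyCompactSpace M := Manifold.locallyCompact_of_finiteDimensional J
  have : IsManifold I n G := LieGroup.toContMDiffMul.toIsManifold
  exact (contMDiff_smul_const I J n x).surjective_mfderiv_of_nhds_le_map hn
    (finrank_range_mfderiv_smul_const_le I J (zero_lt_one.trans_le hn).ne' x g)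
    ((isOpenMap_smul_of_sigmaCompact x).nhds_le g)

variable {E'' : Type*} [NormedAddCommGroup E''] [NormedSpace ℝ E''] {H'' : Type*}
  [TopologicalSpace H''] (K : ModelWithCorners ℝ E'' H'')
  {N : Type*} [TopologicalSpace N] [ChartedSpace H'' N] [MulAction G N]

/-- Equivariant maps from a transitive `G`-manifold are smooth. -/
theorem contMDiff_of_map_smul [ContMDiffSMul I K n G N] (hn : 1 ≤ n) {F : M → N}
    (hF : ∀ (g : G) x, F (g • x) = g • F x) :
    ContMDiff J K n F := by
  intro x
  have h1 : F ∘ (fun g : G => g • x) = fun g : G => g • F x := funext fun g => hF g x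
  have h2 := ((contMDiff_smul_const I J n x) (1 : G)).of_comp_submersion (g := F) (K := K)
    (zero_lt_one.trans_le hn).ne' (surjective_mfderiv_smul_const I J hn x 1) (by
      rw [h1]; exact contMDiff_smul_const I K n (F x) 1)
  simpa using h2

end TransitiveAction

/-! ### Comparison and transport of smooth structures -/

namespace SmoothStructure

theorem atlas_eq_maximalAtlas {X : Type*} (S : SmoothStructure X) :
    atlas (EuclideanSpace ℝ (Fin S.dim)) S.Space = IsManifold.maximalAtlas (𝓡 S.dim) ∞ S.Space := by
  refine Set.Subset.antisymm IsManifold.subset_maximalAtlas fun e he => S.maximal e fun e' he' => ?_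
  exact IsManifold.mem_maximalAtlas_iff.1 he e' he'

/-- By maximality the charts are determined by which maps are smooth, so atlases can be compared
through smooth maps alone. -/
theorem mem_atlas_iff {X : Type*} (S : SmoothStructure X)
    (e : OpenPartialHomeomorph S.Space (EuclideanSpace ℝ (Fin S.dim))) :
    e ∈ atlas (EuclideanSpace ℝ (Fin S.dim)) S.Space ↔
      ContMDiffOn (𝓡 S.dim) (𝓡 S.dim) ∞ e e.source ∧
        ContMDiffOn (𝓡 S.dim) (𝓡 S.dim) ∞ e.symm e.target := by
  rw [S.atlas_eq_maximalAtlas, IsManifold.mem_maximalAtlas_iff_contMDiffOn]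

/-- Two smooth structures on a nonempty set agree if the identity is a diffeomorphism. -/
theorem eq_of_contMDiff {X : Type*} [Nonempty X] {S S' : SmoothStructure X}
    (h : ContMDiff (𝓡 S.dim) (𝓡 S'.dim) ∞ (fun x => S'.toSpace (S.toSpace.symm x)))
    (h' : ContMDiff (𝓡 S'.dim) (𝓡 S.dim) ∞ (fun x => S.toSpace (S'.toSpace.symm x))) :
    S = S' := by
  -- A point is needed here: its tangent spaces are isomorphic. The empty set carries structures of
  -- every dimension.
  have hdim : S.dim = S'.dim := by
    let Φ : S.Space ≃ₘ⟮𝓡 S.dim, 𝓡 S'.dim⟯ S'.Space := ⟨S.toSpace.symm.trans S'.toSpace, h, h'⟩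
    let A : EuclideanSpace ℝ (Fin S.dim) ≃L[ℝ] EuclideanSpace ℝ (Fin S'.dim) :=
      Φ.mfderivToContinuousLinearEquiv (by simp) (S.toSpace (Classical.arbitrary X))
    simpa using A.toLinearEquiv.finrank_eq
  have htop : S.topology = S'.topology :=
    le_antisymm (continuous_id_iff_le.1 h.continuous) (continuous_id_iff_le.1 h'.continuous)
  have hpull {k : ℕ} {u : X → EuclideanSpace ℝ (Fin k)} {s : Set X}
      (hu : ContMDiffOn (M := S.Space) (𝓡 S.dim) (𝓡 k) ∞ u s) :
      ContMDiffOn (M := S'.Space) (𝓡 S'.dim) (𝓡 k) ∞ u s :=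
    ContMDiffOn.comp (M := S'.Space) (M' := S.Space) hu h'.contMDiffOn fun _ hx => hx
  have hpull' {k : ℕ} {u : X → EuclideanSpace ℝ (Fin k)} {s : Set X}
      (hu : ContMDiffOn (M := S'.Space) (𝓡 S'.dim) (𝓡 k) ∞ u s) :
      ContMDiffOn (M := S.Space) (𝓡 S.dim) (𝓡 k) ∞ u s :=
    ContMDiffOn.comp (M := S.Space) (M' := S'.Space) hu h.contMDiffOn fun _ hx => hx
  have hpush {k : ℕ} {u : EuclideanSpace ℝ (Fin k) → X} {s : Set (EuclideanSpace ℝ (Fin k))}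
      (hu : ContMDiffOn (M := EuclideanSpace ℝ (Fin k)) (M' := S.Space) (𝓡 k) (𝓡 S.dim) ∞ u s) :
      ContMDiffOn (M' := S'.Space) (𝓡 k) (𝓡 S'.dim) ∞ u s :=
    h.comp_contMDiffOn hu
  have hpush' {k : ℕ} {u : EuclideanSpace ℝ (Fin k) → X} {s : Set (EuclideanSpace ℝ (Fin k))}
      (hu : ContMDiffOn (M := EuclideanSpace ℝ (Fin k)) (M' := S'.Space) (𝓡 k) (𝓡 S'.dim) ∞ u s) :
      ContMDiffOn (M' := S.Space) (𝓡 k) (𝓡 S.dim) ∞ u s :=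
    h'.comp_contMDiffOn hu
  have hmem := S.mem_atlas_iff
  have hmem' := S'.mem_atlas_iff
  cases S with | mk d hT hC A hA hA' hA'' =>
  cases S' with | mk d' hT' hC' A' hB hB' hB'' =>
  cases hdim
  cases htop
  have : A = A' := by
    ext e
    exact (hmem e).trans (Iff.trans ⟨fun he => ⟨hpull he.1, hpush he.2⟩,
      fun he => ⟨hpull' he.1, hpush' he.2⟩⟩ (hmem' e).symm)
  cases this
  rfl

section Pullback

variable {X M : Type*} {m : ℕ} [TopologicalSpace M] [T2Space M] [SecondCountableTopology M]
  [ChartedSpace (EuclideanSpace ℝ (Fin m)) M] [IsManifold (𝓡 m) ∞ M]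

/-- The smooth structure on a set `X` which makes a bijection of `X` with a manifold a
diffeomorphism. -/
def pullback (f : X ≃ M) : SmoothStructure X :=
  letI : TopologicalSpace X := .induced f inferInstance
  let h : X ≃ₜ M := f.toHomeomorphOfIsInducing ⟨rfl⟩
  { dim := m
    topology := inferInstance
    t2Space := h.isEmbedding.t2Space
    secondCountable := h.isEmbedding.secondCountableTopology
    charts := {e | h.symm.toOpenPartialHomeomorph.trans e ∈ IsManifold.maximalAtlas (𝓡 m) ∞ M}
    exists_chart x := by
      refine ⟨h.toOpenPartialHomeomorph.trans (chartAt _ (h x)), ?_, by simp⟩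
      have : h.symm.toOpenPartialHomeomorph.trans
          (h.toOpenPartialHomeomorph.trans (chartAt (EuclideanSpace ℝ (Fin m)) (h x))) =
          chartAt _ (h x) := by
        ext <;> simp
      rw [Set.mem_ofPred_eq, this]
      exact IsManifold.chart_mem_maximalAtlas _
    compatible e he e' he' := by
      have := IsManifold.compatible_of_mem_maximalAtlas he he'
      have h1 : (h.symm.toOpenPartialHomeomorph.trans e).symm.trans
          (h.symm.toOpenPartialHomeomorph.trans e') = e.symm.trans e' := by
        ext <;> simp
      rwa [h1] at this
    maximal e he := by
      rw [Set.mem_ofPred_eq, IsManifold.mem_maximalAtlas_iff]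
      -- A chart `c` of `M` is tested through its pullback to `X`, which belongs to `charts`; the
      -- homeomorphism `h` then cancels in the transition maps.
      intro c hc
      have h1 := he (h.toOpenPartialHomeomorph.trans c) (by
        have : h.symm.toOpenPartialHomeomorph.trans (h.toOpenPartialHomeomorph.trans c) = c := by
          ext <;> simp
        rw [Set.mem_ofPred_eq, this]
        exact IsManifold.subset_maximalAtlas hc)
      have h2 : (h.symm.toOpenPartialHomeomorph.trans e).symm.trans c =
          e.symm.trans (h.toOpenPartialHomeomorph.trans c) := by
        ext <;> simp
      have h3 : c.symm.trans (h.symm.toOpenPartialHomeomorph.trans e) =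
          (h.toOpenPartialHomeomorph.trans c).symm.trans e := by
        ext <;> simp
      rwa [h2, h3] }

noncomputable instance (f : X ≃ M) :
    ChartedSpace (EuclideanSpace ℝ (Fin m)) (pullback (m := m) f).Space :=
  inferInstanceAs
    (ChartedSpace (EuclideanSpace ℝ (Fin (pullback (m := m) f).dim)) (pullback (m := m) f).Space)

instance (f : X ≃ M) : IsManifold (𝓡 m) ∞ (pullback (m := m) f).Space :=
  inferInstanceAs (IsManifold (𝓡 (pullback (m := m) f).dim) ∞ (pullback (m := m) f).Space)

/-- The bijection which defines a pullback structure, as a homeomorphism. -/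
def pullbackHomeomorph (f : X ≃ M) : (pullback (m := m) f).Space ≃ₜ M :=
  Equiv.toHomeomorphOfIsInducing (X := (pullback (m := m) f).Space) f ⟨rfl⟩

theorem trans_mem_atlas_pullback (f : X ≃ M)
    {c : OpenPartialHomeomorph M (EuclideanSpace ℝ (Fin m))}
    (hc : c ∈ IsManifold.maximalAtlas (𝓡 m) ∞ M) :
    (pullbackHomeomorph (m := m) f).toOpenPartialHomeomorph.trans c ∈
      atlas (EuclideanSpace ℝ (Fin m)) (pullback (m := m) f).Space := by
  change (pullbackHomeomorph (m := m) f).symm.toOpenPartialHomeomorph.trans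
    ((pullbackHomeomorph (m := m) f).toOpenPartialHomeomorph.trans c) ∈
      IsManifold.maximalAtlas (𝓡 m) ∞ M
  have : (pullbackHomeomorph (m := m) f).symm.toOpenPartialHomeomorph.trans
      ((pullbackHomeomorph (m := m) f).toOpenPartialHomeomorph.trans c) = c := by
    ext <;> simp
  rwa [this]

/-- The bijection which defines a pullback structure, as a diffeomorphism. -/
def pullbackDiffeomorph (f : X ≃ M) : (pullback (m := m) f).Space ≃ₘ⟮𝓡 m, 𝓡 m⟯ M where
  toEquiv := (pullbackHomeomorph (m := m) f).toEquiv
  contMDiff_toFun x := by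
    set h := pullbackHomeomorph (m := m) f
    set c := chartAt (EuclideanSpace ℝ (Fin m)) (h x)
    have hc : c ∈ IsManifold.maximalAtlas (𝓡 m) ∞ M := IsManifold.chart_mem_maximalAtlas _
    have hx : h x ∈ c.source := mem_chart_source _ _
    -- Near `x`, the map `h` is the chart `h` followed by `c` of the pullback structure, followed by
    -- the smooth inverse of `c`.
    have h1 : ContMDiffAt (𝓡 m) (𝓡 m) ∞ (h.toOpenPartialHomeomorph.trans c) x :=
      contMDiffAt_of_mem_maximalAtlas
        (IsManifold.subset_maximalAtlas (trans_mem_atlas_pullback f hc)) (by simpa using hx)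
    have h2 := (contMDiffAt_symm_of_mem_maximalAtlas hc (c.map_source hx)).comp x h1
    refine h2.congr_of_eventuallyEq ?_
    filter_upwards [h.continuous.continuousAt.preimage_mem_nhds (c.open_source.mem_nhds hx)]
      with y hy
    exact (c.left_inv hy).symm
  contMDiff_invFun y := by
    set h := pullbackHomeomorph (m := m) f
    set c := chartAt (EuclideanSpace ℝ (Fin m)) y
    have hc : c ∈ IsManifold.maximalAtlas (𝓡 m) ∞ M := IsManifold.chart_mem_maximalAtlas _
    have hy : y ∈ c.source := mem_chart_source _ _
    have h1 : ContMDiffAt (𝓡 m) (𝓡 m) ∞ (h.toOpenPartialHomeomorph.trans c).symm (c y) :=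
      contMDiffAt_symm_of_mem_maximalAtlas
        (IsManifold.subset_maximalAtlas (trans_mem_atlas_pullback f hc))
        (by simpa using c.map_source hy)
    have h2 := h1.comp y (contMDiffAt_of_mem_maximalAtlas hc hy)
    refine h2.congr_of_eventuallyEq ?_
    filter_upwards [c.open_source.mem_nhds hy] with z hz
    exact congrArg h.symm (c.left_inv hz).symm

end Pullback

end SmoothStructure

/-! ### Structures with smooth transitive action -/

namespace SmoothStructure

section Action

variable {r m : ℕ} {G M X : Type*} [Group G] [TopologicalSpace G]
  [ChartedSpace (EuclideanSpace ℝ (Fin r)) G] [TopologicalSpace M]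
  [ChartedSpace (EuclideanSpace ℝ (Fin m)) M] [MulAction G M] [MulAction G X]

/-- A smooth action is transported to a smooth action by an equivariant diffeomorphism. -/
theorem contMDiffSMul_of_diffeomorph [ContMDiffSMul (𝓡 r) (𝓡 m) ∞ G M] {S : SmoothStructure X}
    (Φ : M ≃ₘ⟮𝓡 m, 𝓡 S.dim⟯ S.Space) (hΦ : ∀ (g : G) x, Φ (g • x) = g • Φ x) :
    ContMDiffSMul (𝓡 r) (𝓡 S.dim) ∞ G S.Space where
  contMDiff_smul := by
    have h1 : ContMDiff ((𝓡 r).prod (𝓡 S.dim)) (𝓡 S.dim) ∞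
        fun p : G × S.Space => Φ (p.1 • Φ.symm p.2) :=
      Φ.contMDiff.comp ((contMDiff_smul (I := 𝓡 r) (I' := 𝓡 m) (n := ∞) (G := G) (M := M)).comp
        (contMDiff_fst.prodMk (Φ.symm.contMDiff.comp contMDiff_snd)))
    refine h1.congr fun p => ?_
    rw [hΦ, Φ.apply_symm_apply]

variable [SecondCountableTopology G] [LieGroup (𝓡 r) ∞ G] [T2Space M] [IsManifold (𝓡 m) ∞ M]
  [MulAction.IsPretransitive G M]

/-- A smooth structure on a set with a transitive action of `G`, equivariantly in bijection with a
`G`-manifold, makes the action smooth if and only if the bijection is a diffeomorphism. -/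
theorem contMDiffSMul_iff_exists_diffeomorph [ContMDiffSMul (𝓡 r) (𝓡 m) ∞ G M] (f : M ≃ X)
    (hf : ∀ (g : G) x, f (g • x) = g • f x)
    (S : SmoothStructure X) :
    ContMDiffSMul (𝓡 r) (𝓡 S.dim) ∞ G S.Space ↔
      ∃ Φ : M ≃ₘ⟮𝓡 m, 𝓡 S.dim⟯ S.Space, ∀ x, Φ x = S.toSpace (f x) := by
  constructor
  · intro hS
    have : MulAction.IsPretransitive G S.Space :=
      MulAction.IsPretransitive.of_surjective_map (f := (⟨f, hf⟩ : M →[G] X)) f.surjective ‹_›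
    refine ⟨⟨f.trans S.toSpace, ?_, ?_⟩, fun x => rfl⟩
    -- Both `f` and its inverse are equivariant between transitive `G`-manifolds, so both are smooth
    -- automatically.
    · exact contMDiff_of_map_smul (G := G) (𝓡 r) (𝓡 m) (𝓡 S.dim) (by simp) hf
    · refine contMDiff_of_map_smul (G := G) (𝓡 r) (𝓡 S.dim) (𝓡 m) (n := ∞) (by simp) fun g x => ?_
      refine f.injective ?_
      exact (f.apply_symm_apply _).trans
        ((hf g _).trans (congrArg (g • ·) (f.apply_symm_apply _))).symm
  · rintro ⟨Φ, hΦ⟩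
    refine contMDiffSMul_of_diffeomorph Φ fun g x => ?_
    rw [hΦ, hΦ, hf]
    rfl

/-- A set with a transitive action of `G`, equivariantly in bijection with a `G`-manifold, has
exactly one smooth structure which makes the action smooth. -/
theorem existsUnique_contMDiffSMul [ContMDiffSMul (𝓡 r) (𝓡 m) ∞ G M]
    [SecondCountableTopology M] [Nonempty M] (f : M ≃ X)
    (hf : ∀ (g : G) x, f (g • x) = g • f x) :
    ∃! S : SmoothStructure X, ContMDiffSMul (𝓡 r) (𝓡 S.dim) ∞ G S.Space := by
  have : Nonempty X := f.symm.nonempty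
  let Ψ : M ≃ₘ⟮𝓡 m, 𝓡 (pullback (m := m) f.symm).dim⟯ (pullback (m := m) f.symm).Space :=
    (pullbackDiffeomorph (m := m) f.symm).symm
  have hΨ : ∀ x, Ψ x = (pullback (m := m) f.symm).toSpace (f x) := fun x => rfl
  refine ⟨pullback (m := m) f.symm,
    (contMDiffSMul_iff_exists_diffeomorph (m := m) f hf _).2 ⟨Ψ, hΨ⟩, fun S hS => ?_⟩
  obtain ⟨Φ, hΦ⟩ := (contMDiffSMul_iff_exists_diffeomorph (m := m) f hf S).1 hS
  -- `Φ` and `Ψ` have the same underlying map `f`, so the identity from one structure to the other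
  -- is `Ψ ∘ Φ.symm`.
  refine eq_of_contMDiff ((Ψ.contMDiff.comp Φ.symm.contMDiff).congr fun x => ?_)
    ((Φ.contMDiff.comp Ψ.symm.contMDiff).congr fun x => ?_)
  · obtain ⟨y, rfl⟩ := Φ.surjective x
    rw [Function.comp, Diffeomorph.coe_toEquiv, Φ.symm_apply_apply, hΦ, hΨ, Equiv.symm_apply_apply]
  · obtain ⟨y, rfl⟩ := Ψ.surjective x
    rw [Function.comp, Diffeomorph.coe_toEquiv, Ψ.symm_apply_apply, hΦ, hΨ, Equiv.symm_apply_apply]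

end Action

/-! ### The coset space of an isotropy group -/

section Quotient

variable {r m : ℕ} {G M : Type*} [Group G] [TopologicalSpace G] [SecondCountableTopology G]
  [ChartedSpace (EuclideanSpace ℝ (Fin r)) G] [LieGroup (𝓡 r) ∞ G] [TopologicalSpace M]
  [T2Space M] [ChartedSpace (EuclideanSpace ℝ (Fin m)) M] [IsManifold (𝓡 m) ∞ M] [MulAction G M]
  [MulAction.IsPretransitive G M]

variable (G) in
/-- The bijection `G ⧸ H → M`, `gH ↦ g • x`, for the stabilizer `H` of a point `x`. -/
noncomputable def quotientStabilizerEquiv (x : M) : G ⧸ MulAction.stabilizer G x ≃ M :=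
  Equiv.ofBijective (MulAction.ofQuotientStabilizer G x)
    ⟨MulAction.injective_ofQuotientStabilizer G x, fun y => by
      obtain ⟨g, rfl⟩ := MulAction.exists_smul_eq G x y
      exact ⟨g, MulAction.ofQuotientStabilizer_mk G x g⟩⟩

omit [TopologicalSpace M] [TopologicalSpace G] [SecondCountableTopology G]
  [ChartedSpace (EuclideanSpace ℝ (Fin r)) G] [LieGroup (𝓡 r) ∞ G]
  [T2Space M] [ChartedSpace (EuclideanSpace ℝ (Fin m)) M] [IsManifold (𝓡 m) ∞ M] in
theorem quotientStabilizerEquiv_mk (x : M) (g : G) :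
    quotientStabilizerEquiv G x (g : G ⧸ MulAction.stabilizer G x) = g • x := rfl

/-- The projection and the orbit map are surjective submersions from `G`, and the bijection
intertwines them. Each direction is smooth by descent along one of the two. -/
theorem IsQuotientStructure.exists_diffeomorph [ContMDiffSMul (𝓡 r) (𝓡 m) ∞ G M] {x : M}
    {Q : SmoothStructure (G ⧸ MulAction.stabilizer G x)} (hQ : Q.IsQuotientStructure r) :
    ∃ Θ : Q.Space ≃ₘ⟮𝓡 Q.dim, 𝓡 m⟯ M, ∀ q, Θ (Q.toSpace q) = quotientStabilizerEquiv G x q := by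
  refine ⟨⟨Q.toSpace.symm.trans (quotientStabilizerEquiv G x), ?_, ?_⟩, fun q => rfl⟩
  · exact hQ.contMDiff_mk.of_comp_submersion (by simp) QuotientGroup.mk_surjective
      hQ.surjective_mfderiv (contMDiff_smul_const (𝓡 r) (𝓡 m) ∞ x)
  · refine (contMDiff_smul_const (𝓡 r) (𝓡 m) ∞ x).of_comp_submersion (by simp)
      (MulAction.surjective_smul G x)
      (surjective_mfderiv_smul_const (𝓡 r) (𝓡 m) (n := ∞) (by simp) x)
      (hQ.contMDiff_mk.congr fun g => ?_)
    exact congrArg Q.toSpace ((quotientStabilizerEquiv G x).symm_apply_apply g)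

/-- Transport to `M` turns the projection into the orbit map, which is a smooth submersion and,
being an open continuous surjection, a quotient map. -/
theorem isQuotientStructure_pullback [ContMDiffSMul (𝓡 r) (𝓡 m) ∞ G M] [SecondCountableTopology M]
    (x : M) :
    (pullback (m := m) (quotientStabilizerEquiv G x)).IsQuotientStructure r where
  topology_eq := by
    have : IsTopologicalGroup G := topologicalGroup_of_lieGroup (𝓡 r) ∞
    have : ContinuousSMul G M := ContMDiffSMul.continuousSMul (I := 𝓡 r) (I' := 𝓡 m) ∞
    have : LocallyCompactSpace G := Manifold.locallyCompact_of_finiteDimensional (𝓡 r)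
    have : LocallyCompactSpace M := Manifold.locallyCompact_of_finiteDimensional (𝓡 m)
    have h1 : Topology.IsQuotientMap (fun g : G => g • x) :=
      (isOpenMap_smul_of_sigmaCompact x).isQuotientMap (by fun_prop) (MulAction.surjective_smul G x)
    have h2 :=
      (pullbackHomeomorph (m := m) (quotientStabilizerEquiv G x)).symm.isQuotientMap.comp h1
    have h3 : (pullbackHomeomorph (m := m) (quotientStabilizerEquiv G x)).symm ∘
        (fun g : G => g • x) = fun g : G => toSpace _ (g : G ⧸ MulAction.stabilizer G x) :=
      funext fun g => (quotientStabilizerEquiv G x).symm_apply_apply g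
    rw [h3] at h2
    exact h2.eq_coinduced
  contMDiff_mk :=
    ((pullbackDiffeomorph (quotientStabilizerEquiv G x)).symm.contMDiff.comp
      (contMDiff_smul_const (𝓡 r) (𝓡 m) ∞ x)).congr fun g =>
        ((quotientStabilizerEquiv G x).symm_apply_apply g).symm
  surjective_mfderiv g := by
    set Θ := pullbackDiffeomorph (m := m) (quotientStabilizerEquiv G x)
    have h1 : (fun g : G => toSpace (pullback (m := m) (quotientStabilizerEquiv G x))
        (g : G ⧸ MulAction.stabilizer G x)) = Θ.symm ∘ fun g : G => g • x :=
      funext fun g => ((quotientStabilizerEquiv G x).symm_apply_apply g).symm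
    have h2 : mfderiv (𝓡 r) (𝓡 m) (Θ.symm ∘ fun g : G => g • x) g = _ :=
      mfderiv_comp g (Θ.symm.contMDiff.mdifferentiable (by simp) _)
        ((contMDiff_smul_const (𝓡 r) (𝓡 m) ∞ x).mdifferentiable (by simp) _)
    change Function.Surjective (mfderiv (𝓡 r) (𝓡 m) (fun g : G =>
      toSpace (pullback (m := m) (quotientStabilizerEquiv G x))
        (g : G ⧸ MulAction.stabilizer G x)) g)
    rw [h1, h2]
    exact (Θ.symm.mfderivToContinuousLinearEquiv (by simp) (g • x)).surjective.comp
      (surjective_mfderiv_smul_const (𝓡 r) (𝓡 m) (n := ∞) (by simp) x g)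

/-- For uniqueness, the identity between two such structures composed with one projection is the
other, so it is smooth by descent in both directions. -/
theorem existsUnique_isQuotientStructure [ContMDiffSMul (𝓡 r) (𝓡 m) ∞ G M]
    [SecondCountableTopology M] (x : M) :
    ∃! Q : SmoothStructure (G ⧸ MulAction.stabilizer G x), Q.IsQuotientStructure r := by
  have hP := isQuotientStructure_pullback (r := r) (m := m) (G := G) x
  refine ⟨_, hP, fun Q hQ => eq_of_contMDiff ?_ ?_⟩
  · exact hQ.contMDiff_mk.of_comp_submersion (by simp) QuotientGroup.mk_surjective
      hQ.surjective_mfderiv hP.contMDiff_mk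
  · exact hP.contMDiff_mk.of_comp_submersion (by simp) QuotientGroup.mk_surjective
      hP.surjective_mfderiv hQ.contMDiff_mk

end Quotient

end SmoothStructure

/-! ### Application to `GM` and `GG` -/

namespace EquivariantMap

variable {r m : ℕ} {G M : Type*} [Group G] [TopologicalSpace G]
  [ChartedSpace (EuclideanSpace ℝ (Fin r)) G] [TopologicalSpace M]
  [ChartedSpace (EuclideanSpace ℝ (Fin m)) M] [MulAction G M]
  [ContMDiffSMul (𝓡 r) (𝓡 m) ∞ G M]

variable (r m G M) in
/-- The bijection `x ↦ ψ_x` of `M` with `GM`. -/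
def psiEquiv : M ≃ EquivariantMap r m G M where
  toFun := psi r m G
  invFun f := f.toFun 1
  left_inv x := one_smul G x
  right_inv := psi_apply_one

end EquivariantMap

theorem corollary3p18 {r m : ℕ} {G M : Type*}
    [Group G] [TopologicalSpace G] [T2Space G] [SecondCountableTopology G]
    [ChartedSpace (EuclideanSpace ℝ (Fin r)) G] [LieGroup (𝓡 r) ∞ G]
    [TopologicalSpace M] [T2Space M] [SecondCountableTopology M] [Nonempty M]
    [ChartedSpace (EuclideanSpace ℝ (Fin m)) M] [IsManifold (𝓡 m) ∞ M]
    [MulAction G M] [ContMDiffSMul (𝓡 r) (𝓡 m) ∞ G M] [MulAction.IsPretransitive G M] :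
    -- a unique manifold topology and smooth structure on `GM` makes the induced action smooth
    (∃! S : SmoothStructure (EquivariantMap r m G M),
      ContMDiffSMul (𝓡 r) (𝓡 S.dim) ∞ G S.Space) ∧
    -- it is the one for which `x ↦ ψ_x` is a diffeomorphism `M ≅ GM`
    (∀ S : SmoothStructure (EquivariantMap r m G M),
      ContMDiffSMul (𝓡 r) (𝓡 S.dim) ∞ G S.Space ↔
        ∃ Φ : M ≃ₘ⟮𝓡 m, 𝓡 S.dim⟯ S.Space,
          ∀ x, Φ x = S.toSpace (EquivariantMap.psi r m G x)) ∧
    -- for the isotropy group `H` of any point, `G ⧸ H` is a manifold in exactly one way, and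
    -- `M ≅ G ⧸ H ≅ GM`
    (∀ x : M,
      (∃! Q : SmoothStructure (G ⧸ MulAction.stabilizer G x), Q.IsQuotientStructure r) ∧
      ∀ Q : SmoothStructure (G ⧸ MulAction.stabilizer G x), Q.IsQuotientStructure r →
        (∃ Θ : Q.Space ≃ₘ⟮𝓡 Q.dim, 𝓡 m⟯ M,
          ∀ g : G, Θ (Q.toSpace (g : G ⧸ MulAction.stabilizer G x)) = g • x) ∧
        ∀ S : SmoothStructure (EquivariantMap r m G M),
          ContMDiffSMul (𝓡 r) (𝓡 S.dim) ∞ G S.Space ↔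
            ∃ Θ : Q.Space ≃ₘ⟮𝓡 Q.dim, 𝓡 S.dim⟯ S.Space,
              ∀ g : G, Θ (Q.toSpace (g : G ⧸ MulAction.stabilizer G x)) =
                g • S.toSpace (EquivariantMap.psi r m G x)) ∧
    -- the case of `G` acting on itself by left translations: `GG ≅ G`
    ((∃! S : SmoothStructure (EquivariantMap r r G G),
      ContMDiffSMul (𝓡 r) (𝓡 S.dim) ∞ G S.Space) ∧
    ∀ S : SmoothStructure (EquivariantMap r r G G),
      ContMDiffSMul (𝓡 r) (𝓡 S.dim) ∞ G S.Space ↔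
        ∃ Φ : G ≃ₘ⟮𝓡 r, 𝓡 S.dim⟯ S.Space,
          ∀ g, Φ g = S.toSpace (EquivariantMap.psi r r G g)) := by
  have hψ : ∀ (g : G) (x : M), EquivariantMap.psiEquiv r m G M (g • x) =
      g • EquivariantMap.psiEquiv r m G M x := fun g x => (EquivariantMap.smul_psi g x).symm
  have hψG : ∀ g h : G, EquivariantMap.psiEquiv r r G G (g • h) =
      g • EquivariantMap.psiEquiv r r G G h := fun g h => (EquivariantMap.smul_psi g h).symm
  have hG : IsManifold (𝓡 r) ∞ G := LieGroup.toContMDiffMul.toIsManifold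
  have hM := SmoothStructure.contMDiffSMul_iff_exists_diffeomorph (r := r) (m := m)
    (EquivariantMap.psiEquiv r m G M) hψ
  refine ⟨SmoothStructure.existsUnique_contMDiffSMul (m := m) _ hψ, hM, fun x =>
    ⟨SmoothStructure.existsUnique_isQuotientStructure (m := m) x, fun Q hQ => ?_⟩,
    SmoothStructure.existsUnique_contMDiffSMul (m := r) _ hψG,
    SmoothStructure.contMDiffSMul_iff_exists_diffeomorph (m := r) _ hψG⟩
  -- Composing with `Θ` or its inverse converts the criterion on `M` into the one on `G ⧸ H` and
  -- back.
  obtain ⟨Θ, hΘ⟩ := hQ.exists_diffeomorph (m := m)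
  refine ⟨⟨Θ, fun g => hΘ g⟩, fun S => (hM S).trans ⟨?_, ?_⟩⟩
  · rintro ⟨Φ, hΦ⟩
    refine ⟨Θ.trans Φ, fun g => ?_⟩
    rw [Diffeomorph.coe_trans, Function.comp, hΘ, hΦ,
      SmoothStructure.quotientStabilizerEquiv_mk, hψ]
    rfl
  · rintro ⟨Ψ, hΨ⟩
    refine ⟨Θ.symm.trans Ψ, fun y => ?_⟩
    obtain ⟨g, rfl⟩ := MulAction.exists_smul_eq G x y
    have : Θ.symm (g • x) = Q.toSpace (g : G ⧸ MulAction.stabilizer G x) :=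
      Θ.symm_apply_eq.2 (hΘ g).symm
    rw [Diffeomorph.coe_trans, Function.comp, this, hΨ, hψ]
    rfl
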